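/- Let $M$ be a smooth Hausdorff manifold of dimension $n$ and let $(P,N)$ be a Poisson–Nijenhuis structure on $M$. That is: $P$ is a smooth Poisson bivector, viewed also as the map $T^*M\to TM$, $P\alpha=i_\alpha P$; $N$ is a smooth $(1,1)$-tensor with vanishing Nijenhuis torsion, whose transpose on $1$-forms is also written $N$; and $P$ and $N$ are compatible, i.e. $NP=PN$ and, for all $1$-forms $\alpha,\beta$, $$[\alpha,\beta]_{NP}=[N\alpha,\beta]_P+[\alpha,N\beta]_P-N[\alpha,\beta]_P ,$$ where $[\alpha,\beta]_Q=L_{Q\alpha}\beta-L_{Q\beta}\alpha-d(Q(\alpha,\beta))$ for a bivector $Q$. For $k\ge 0$ set $P_k=N^kP$. For a bivector $Q$ and functions $f,g$ let $H^Q_f=Q\,df$ and $\{f,g\}_Q=Q(df,dg)=H^Q_f(g)$. Let $\mu$ be a volume form on $M$ (a smooth nowhere vanishing $n$-form). Then for every $k\ge 0$ there is a unique smooth vector field $X^k_\mu$ (the modular vector field of $P_k$ with respect to $\mu$) such that $$\langle X^k_\mu,df\rangle\,\mu=L_{H^{P_k}_f}\mu\qquad\text{for all } f\in C^\infty(M).$$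 For $k\ge 1$ put $X^{(k)}=X^k_\mu-N X^{k-1}_\mu$ and $I_k=\operatorname{Tr}\frac{N^k}{k}=\frac1k\operatorname{Tr}(N^k)$. The functions $I_k$ are smooth and in involution, $\{I_j,I_k\}_{P_l}=0$ for all $j,k\ge 1$ and $l\ge 0$, and $$X^{(k)}=-\tfrac12\,H^P_{I_k}=-\tfrac12\,P\,d\operatorname{Tr}\frac{N^k}{k}\qquad\text{for all } k\ge 1 .$$ Hence the hierarchy $(X^{(k)})_{k\ge1}$ does not depend on $\mu$ and is, up to the factor $-\tfrac12$, the canonical bihamiltonian hierarchy of $(P,N)$: for all $k\ge 1$, $$X^{(k+1)}=N X^{(k)}=-\tfrac12\,P\,dI_{k+1}=-\tfrac12\,NP\,dI_k .$$ -/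

import Mathlib

open Bundle Manifold ContDiff VectorField

noncomputable section

namespace PoissonNijenhuis

/-! Throughout, `M` is a smooth manifold without boundary, modelled on `ℝⁿ`. Tensor fields are
dependent functions on `M`, with smoothness as a separate predicate. -/

section Tensors

variable (n : ℕ) (M : Type*) [TopologicalSpace M]
  [ChartedSpace (EuclideanSpace ℝ (Fin n)) M]

/-- Vector fields on `M`. -/
abbrev VField := ∀ x : M, TangentSpace (𝓡 n) x

/-- Differential 1-forms on `M`. -/
abbrev OneForm := ∀ x : M, TangentSpace (𝓡 n) x →L[ℝ] ℝ

/-- (1,1)-tensors on `M`, as fields of endomorphisms of the tangent spaces. -/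
abbrev EndField := ∀ x : M, TangentSpace (𝓡 n) x →L[ℝ] TangentSpace (𝓡 n) x

/-- Contravariant 2-tensors `P` on `M`, as fields of linear maps `T*M → TM`, `α ↦ P α = i_α P`.
The corresponding bilinear form is `P(α, β) = ⟨β, P α⟩`. -/
abbrev BiField := ∀ x : M, (TangentSpace (𝓡 n) x →L[ℝ] ℝ) →L[ℝ] TangentSpace (𝓡 n) x

/-- Differential forms of top degree `n` on `M`. -/
abbrev TopForm := ∀ x : M, TangentSpace (𝓡 n) x [⋀^Fin n]→L[ℝ] ℝ

end Tensors

variable {n : ℕ} {M : Type*} [TopologicalSpace M]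
  [ChartedSpace (EuclideanSpace ℝ (Fin n)) M]

/-! ### Smoothness -/

section Smoothness

variable [IsManifold (𝓡 n) ∞ M]

/-- Smooth real functions. -/
def SmoothFun (f : M → ℝ) : Prop := ContMDiff (𝓡 n) 𝓘(ℝ, ℝ) ∞ f

/-- Smooth vector fields: smooth sections of the tangent bundle. -/
def SmoothField (X : VField n M) : Prop :=
  ContMDiff (𝓡 n) ((𝓡 n).prod 𝓘(ℝ, EuclideanSpace ℝ (Fin n))) ∞
    (fun x ↦ TotalSpace.mk' (EuclideanSpace ℝ (Fin n)) x (X x))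

/-- Smooth 1-forms: smooth sections of the cotangent bundle. -/
def SmoothOneForm (α : OneForm n M) : Prop :=
  ContMDiff (𝓡 n) ((𝓡 n).prod 𝓘(ℝ, EuclideanSpace ℝ (Fin n) →L[ℝ] ℝ)) ∞
    (fun x ↦ TotalSpace.mk' (EuclideanSpace ℝ (Fin n) →L[ℝ] ℝ) x (α x))

/-- Smooth (1,1)-tensors: smooth sections of the bundle `Hom(TM, TM)`. -/
def SmoothEnd (N : EndField n M) : Prop :=
  ContMDiff (𝓡 n)
    ((𝓡 n).prod 𝓘(ℝ, EuclideanSpace ℝ (Fin n) →L[ℝ] EuclideanSpace ℝ (Fin n))) ∞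
    (fun x ↦ TotalSpace.mk' (EuclideanSpace ℝ (Fin n) →L[ℝ] EuclideanSpace ℝ (Fin n)) x (N x))

/-- Smooth contravariant 2-tensors: smooth sections of the bundle `Hom(T*M, TM)`. -/
def SmoothBi (P : BiField n M) : Prop :=
  ContMDiff (𝓡 n)
    ((𝓡 n).prod 𝓘(ℝ, (EuclideanSpace ℝ (Fin n) →L[ℝ] ℝ) →L[ℝ] EuclideanSpace ℝ (Fin n))) ∞
    (fun x ↦ TotalSpace.mk'
      ((EuclideanSpace ℝ (Fin n) →L[ℝ] ℝ) →L[ℝ] EuclideanSpace ℝ (Fin n)) x (P x))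

/-- Smooth top-degree forms: the evaluation on smooth vector fields is smooth. -/
def SmoothTopForm (μ : TopForm n M) : Prop :=
  ∀ Y : Fin n → VField n M, (∀ i, SmoothField (Y i)) →
    SmoothFun (n := n) (fun x ↦ μ x (fun i ↦ Y i x))

end Smoothness

/-! ### Operations on tensor fields -/

/-- The differential `df` of a function. -/
def d (f : M → ℝ) : OneForm n M := fun x ↦ mvfderiv (𝓡 n) f x

/-- The hamiltonian vector field `H^P_f = P df`. -/
def hamiltonian (P : BiField n M) (f : M → ℝ) : VField n M := fun x ↦ P x (d f x)

/-- The bracket of functions `{f, g}_P = P(df, dg) = H^P_f(g)`. -/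
def bracket (P : BiField n M) (f g : M → ℝ) : M → ℝ := fun x ↦ d g x (hamiltonian P f x)

/-- The Lie derivative of a 1-form, evaluated on a vector field:
`(L_X β)(Z) = X(β(Z)) - β([X, Z])`. -/
def lieOneForm (X : VField n M) (β : OneForm n M) (Z : VField n M) : M → ℝ :=
  fun x ↦ d (fun y ↦ β y (Z y)) x (X x) - β x (mlieBracket (𝓡 n) X Z x)

/-- The Koszul bracket of 1-forms
`[α, β]_P = L_{Pα} β - L_{Pβ} α - d(P(α, β))`, evaluated on a vector field `Z`. -/
def koszulBracket (P : BiField n M) (α β : OneForm n M) (Z : VField n M) : M → ℝ :=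
  fun x ↦ lieOneForm (fun y ↦ P y (α y)) β Z x - lieOneForm (fun y ↦ P y (β y)) α Z x
    - d (fun y ↦ β y (P y (α y))) x (Z x)

/-- The vector field `N X`. -/
def applyField (N : EndField n M) (X : VField n M) : VField n M := fun x ↦ N x (X x)

/-- The transpose of `N` applied to a 1-form: `(N α)(Z) = α(N Z)`. -/
def applyForm (N : EndField n M) (α : OneForm n M) : OneForm n M := fun x ↦ (α x).comp (N x)

/-- The tensor `P_k = N^k P`. -/
def iterBi (N : EndField n M) (P : BiField n M) (k : ℕ) : BiField n M :=
  fun x ↦ ((N x) ^ k).comp (P x)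

/-- The function `I_k = Tr(N^k / k) = (1/k) Tr(N^k)`, for `k ≥ 1`. -/
def traceFun (N : EndField n M) (k : ℕ) : M → ℝ :=
  fun x ↦ (1 / (k : ℝ)) *
    LinearMap.trace ℝ (TangentSpace (𝓡 n) x) ((N x) ^ k : _ →L[ℝ] _).toLinearMap

/-- The Lie derivative of a top-degree form, evaluated on vector fields:
`(L_X μ)(Y₁, …, Yₙ) = X(μ(Y₁, …, Yₙ)) - ∑ᵢ μ(Y₁, …, [X, Yᵢ], …, Yₙ)`. -/
def lieTopForm (X : VField n M) (μ : TopForm n M) (Y : Fin n → VField n M) : M → ℝ :=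
  fun x ↦ d (fun y ↦ μ y (fun i ↦ Y i y)) x (X x)
    - ∑ i, μ x (Function.update (fun j ↦ Y j x) i (mlieBracket (𝓡 n) X (Y i) x))

/-! ### Poisson–Nijenhuis structures, volume forms, modular vector fields -/

section Structures

variable [IsManifold (𝓡 n) ∞ M]

/-- `P` is a Poisson bivector: smooth, skew-symmetric, and its bracket of functions satisfies the
Jacobi identity. -/
structure IsPoisson (P : BiField n M) : Prop where
  smooth : SmoothBi P
  skew : ∀ (x : M) (α β : TangentSpace (𝓡 n) x →L[ℝ] ℝ), β (P x α) = - α (P x β)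
  jacobi : ∀ f g h : M → ℝ, SmoothFun (n := n) f → SmoothFun (n := n) g → SmoothFun (n := n) h →
    ∀ x, bracket P f (bracket P g h) x + bracket P g (bracket P h f) x
      + bracket P h (bracket P f g) x = 0

/-- `N` is a Nijenhuis tensor: smooth, with vanishing Nijenhuis torsion
`[NX, NY] - N[NX, Y] - N[X, NY] + N²[X, Y]`. -/
structure IsNijenhuis (N : EndField n M) : Prop where
  smooth : SmoothEnd N
  torsion : ∀ X Y : VField n M, SmoothField X → SmoothField Y → ∀ x,
    mlieBracket (𝓡 n) (applyField N X) (applyField N Y) x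
      - N x (mlieBracket (𝓡 n) (applyField N X) Y x)
      - N x (mlieBracket (𝓡 n) X (applyField N Y) x)
      + N x (N x (mlieBracket (𝓡 n) X Y x)) = 0

/-- `(P, N)` is a Poisson–Nijenhuis structure: `P` is a Poisson bivector, `N` is a Nijenhuis
tensor, and they are compatible, i.e. `N P = P N` (with the transpose of `N` on the right) and
`[α, β]_{NP} = [Nα, β]_P + [α, Nβ]_P - N[α, β]_P` for all 1-forms `α`, `β`. -/
structure IsPoissonNijenhuis (P : BiField n M) (N : EndField n M) : Prop where
  poisson : IsPoisson P
  nijenhuis : IsNijenhuis N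
  comm : ∀ (x : M) (α : TangentSpace (𝓡 n) x →L[ℝ] ℝ), N x (P x α) = P x (α.comp (N x))
  compat : ∀ (α β : OneForm n M) (Z : VField n M),
    SmoothOneForm α → SmoothOneForm β → SmoothField Z → ∀ x,
    koszulBracket (iterBi N P 1) α β Z x
      = koszulBracket P (applyForm N α) β Z x + koszulBracket P α (applyForm N β) Z x
        - koszulBracket P α β (applyField N Z) x

/-- Volume forms: smooth, nowhere vanishing forms of top degree. -/
structure IsVolumeForm (μ : TopForm n M) : Prop where
  smooth : SmoothTopForm μ
  ne_zero : ∀ x, μ x ≠ 0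

/-- `X` is the modular vector field of `Q` with respect to `μ`: a smooth vector field with
`⟨X, df⟩ μ = L_{H^Q_f} μ` for every smooth function `f`. -/
structure IsModularField (Q : BiField n M) (μ : TopForm n M) (X : VField n M) : Prop where
  smooth : SmoothField X
  eq : ∀ f : M → ℝ, SmoothFun (n := n) f →
    ∀ Y : Fin n → VField n M, (∀ i, SmoothField (Y i)) → ∀ x,
    d f x (X x) * μ x (fun i ↦ Y i x) = lieTopForm (hamiltonian Q f) μ Y x

end Structures

/-- The vector field `X^{(k)} = X^k_μ - N X^{k-1}_μ`, for `k ≥ 1`, built from the sequence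
`Xμ k = X^k_μ`. -/
def modularHierarchy (N : EndField n M) (Xμ : ℕ → VField n M) (k : ℕ) : VField n M :=
  fun x ↦ Xμ k x - N x (Xμ (k - 1) x)

end PoissonNijenhuis

end

/-!
The theorem is local, so it is proved in a coordinate frame: functions `q i` and fields `e j`,
defined on all of `M` by means of a bump function, with `dqⁱ(e_j) = δⁱ_j` on an open set
(`exists_isCoordFrame`). Lie brackets enter only through
`df([X, Y]) = X(Y f) - Y(X f)` (`d_mlieBracket`); in particular the coordinate fields commute, and
all the structures become matrices of smooth functions: `Nⁱ_a = dqⁱ(N e_a)` and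
`P^{ij} = P(dqⁱ, dqʲ)`.

*Modular fields.* If `μ = ρ dq¹ ⋯ dqⁿ` and `X` is a vector field, then
`L_X μ = (X(ρ) / ρ + ∑ ∂_a X^a) μ` (`IsCoordFrame.lieTopForm_eq`). For `X = Q df` with `Q` skew the
second derivatives of `f` cancel, and what remains is a derivation in `f`: it is the vector field
with components `∑ a, (∂_a Q^{ba} + Q^{ba} ∂_a ρ / ρ)`. These components exist near every point and
are determined by the defining equation, so that the local fields glue
(`existsUnique_isModularField`).

*The hierarchy.* Since `P_{k+1} = N P_k`, the terms with `ρ` and those with derivatives of `P_k`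
cancel in `X^{k+1} - N X^k`, which has components `∑ (∂_c N^b_a) P_k^{ac}`. On the differentials of
two functions, the compatibility of `P` and `N` is an identity between first derivatives of `P` and
of `N` (`IsPoissonNijenhuis.d_bracket_iterBi_one`); contracted with `N^k`, and combined with the
derivative of `N P = P Nᵗ`, it loses all derivatives of `P` and becomes
`2 ∑ (∂_c N^b_a) P_k^{ac} = ∑ P^{ba} Tr(N^k ∂_a N)` (`sum_two_mul_of_compat`). Here
`Tr(N^k ∂_a N) = ∂_a I_{k+1}`, which gives `X^{(k+1)} = -½ P dI_{k+1}`
(`IsPoissonNijenhuis.modularHierarchy_eq`).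

*Involution.* The torsion identity contracted with `N^{k-1}` says `N dI_k = dI_{k+1}`
(`IsNijenhuis.d_traceFun_apply`). Hence `{I_j, I_k}_{P_l} = {I_{j+l}, I_k}_P`, and `{I_j, I_k}_P` is
skew in `(j, k)` while it depends only on `j + k`; so it vanishes
(`IsPoissonNijenhuis.bracket_traceFun`).
-/

open Bundle Manifold ContDiff VectorField

noncomputable section

namespace PoissonNijenhuis

open Filter Topology Matrix

/-! ### Differentials of smooth functions and the Lie bracket -/

section

variable {n : ℕ} {M : Type*} [TopologicalSpace M]
  [ChartedSpace (EuclideanSpace ℝ (Fin n)) M]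

/-- The derivative of `g` along `X` at `y`, computed in the chart at `x`. -/
theorem d_apply_eq_fderiv [IsManifold (𝓡 n) ∞ M] {x y : M} (hy : y ∈ (extChartAt (𝓡 n) x).source)
    {g : M → ℝ} (hg : MDifferentiableAt (𝓡 n) 𝓘(ℝ, ℝ) g y) (X : VField n M) :
    d g y (X y) = fderiv ℝ (g ∘ (extChartAt (𝓡 n) x).symm) (extChartAt (𝓡 n) x y)
      (mpullbackWithin 𝓘(ℝ, EuclideanSpace ℝ (Fin n)) (𝓡 n) (extChartAt (𝓡 n) x).symm X
        (Set.range (𝓡 n)) (extChartAt (𝓡 n) x y)) := by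
  set φ := extChartAt (𝓡 n) x with hφ_def
  have hy' : φ y ∈ φ.target := φ.map_source hy
  have : IsManifold (𝓡 n) 1 M := .of_le (n := ∞) (by simp)
  have hφy : φ.symm (φ y) = y := φ.left_inv hy
  have hr : Set.range (𝓡 n) = Set.univ := by simp
  have hφ : MDifferentiableAt 𝓘(ℝ, EuclideanSpace ℝ (Fin n)) (𝓡 n) φ.symm (φ y) := by
    have := mdifferentiableWithinAt_extChartAt_symm (I := 𝓡 n) hy'
    rwa [hr, mdifferentiableWithinAt_univ] at this
  have hinv := isInvertible_mfderivWithin_extChartAt_symm (I := 𝓡 n) hy'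
  rw [mpullbackWithin_apply]
  rw [hr, mfderivWithin_univ] at *
  have h1 := mfderiv_comp_apply_of_eq (x := φ y) (y := y) hg hφ hφy
    ((mfderiv 𝓘(ℝ, EuclideanSpace ℝ (Fin n)) (𝓡 n) φ.symm (φ y)).inverse (X (φ.symm (φ y))))
  rw [mfderiv_eq_fderiv] at h1
  refine Eq.trans ?_ h1.symm
  rw [hinv.self_apply_inverse]
  rw [hφy]; rfl

theorem SmoothFun.mdiff {f : M → ℝ} (hf : SmoothFun (n := n) f) (x : M) :
    MDifferentiableAt (𝓡 n) 𝓘(ℝ, ℝ) f x := (hf x).mdifferentiableAt (by simp)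


theorem d_congr {f g : M → ℝ} {x : M} (h : f =ᶠ[𝓝 x] g) : d (n := n) f x = d g x :=
  h.mfderiv_eq

theorem smoothFun_const (c : ℝ) : SmoothFun (n := n) (fun _ : M ↦ c) := contMDiff_const

theorem SmoothFun.mul {f g : M → ℝ} (hf : SmoothFun (n := n) f) (hg : SmoothFun (n := n) g) :
    SmoothFun (n := n) (fun y ↦ f y * g y) := ContMDiff.mul hf hg

theorem SmoothFun.sum {ι : Type*} {s : Finset ι} {f : ι → M → ℝ}
    (hf : ∀ i ∈ s, SmoothFun (n := n) (f i)) : SmoothFun (n := n) (fun y ↦ ∑ i ∈ s, f i y) :=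
  contMDiff_finsetSum hf

theorem d_const (c : ℝ) (x : M) : d (n := n) (fun _ : M ↦ c) x = 0 := mvfderiv_const c

theorem SmoothFun.d_add {f g : M → ℝ} (hf : SmoothFun (n := n) f) (hg : SmoothFun (n := n) g)
    (x : M) : d (n := n) (fun y ↦ f y + g y) x =
      d f x + d g x :=
  mvfderiv_fun_add (hf.mdiff x) (hg.mdiff x)

theorem SmoothFun.d_mul {f g : M → ℝ} (hf : SmoothFun (n := n) f) (hg : SmoothFun (n := n) g)
    (x : M) : d (n := n) (fun y ↦ f y * g y) x =
      f x • d g x + g x • d f x :=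
  mvfderiv_fun_mul (hf.mdiff x) (hg.mdiff x)

theorem d_neg (f : M → ℝ) (x : M) :
    d (n := n) (fun y ↦ -f y) x = -d f x :=
  mvfderiv_fun_neg

theorem SmoothFun.d_sum {ι : Type*} {s : Finset ι} {f : ι → M → ℝ}
    (hf : ∀ i ∈ s, SmoothFun (n := n) (f i)) (x : M) :
    d (n := n) (fun y ↦ ∑ i ∈ s, f i y) x =
      ∑ i ∈ s, d (f i) x := by
  classical
  induction s using Finset.induction_on with
  | empty => simpa using d_const 0 x
  | insert a s ha ih =>
    simp only [Finset.sum_insert ha]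
    rw [← ih fun i hi ↦ hf i (Finset.mem_insert_of_mem hi),
      ← SmoothFun.d_add (hf a (Finset.mem_insert_self a s))
        (SmoothFun.sum fun i hi ↦ hf i (Finset.mem_insert_of_mem hi))]

variable [IsManifold (𝓡 n) ∞ M]

theorem SmoothOneForm.apply {α : OneForm n M} {X : VField n M} (hα : SmoothOneForm α)
    (hX : SmoothField X) : SmoothFun (n := n) (fun x ↦ α x (X x)) := by
  intro x
  have := (hα x).clm_bundle_apply (E₂ := Bundle.Trivial M ℝ) (F₂ := ℝ) (hX x)
  exact (contMDiffAt_section _).1 this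

theorem SmoothEnd.apply {N : EndField n M} {X : VField n M} (hN : SmoothEnd N)
    (hX : SmoothField X) : SmoothField (applyField N X) :=
  fun x ↦ (hN x).clm_bundle_apply (hX x)

theorem SmoothBi.apply {P : BiField n M} {α : OneForm n M} (hP : SmoothBi P)
    (hα : SmoothOneForm α) : SmoothField (fun x ↦ P x (α x)) :=
  fun x ↦ (hP x).clm_bundle_apply (hα x)

theorem smoothOneForm_d {f : M → ℝ} (hf : SmoothFun (n := n) f) :
    SmoothOneForm (n := n) (M := M) (d f) := by
  intro x
  refine (contMDiffAt_hom_bundle _).2 ⟨contMDiffAt_id, ?_⟩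
  have := ContMDiffAt.mfderiv_const (m := ∞) (hf x) (by simp)
  refine this.congr_of_eventuallyEq (Eventually.of_forall fun y ↦ ?_)
  ext v
  simp [inTangentCoordinates, ContinuousLinearMap.inCoordinates]
  rfl

theorem two_le_infty : (2 : ℕ∞ω) ≤ ∞ := by
  exact WithTop.coe_le_coe.2 (le_top : (2 : ℕ∞) ≤ ⊤)

/-- The Lie bracket acts on functions as the commutator of derivations. The proof reduces to the
bracket of the model space, since the bracket at `x` is defined in the chart at `x`. -/
theorem d_mlieBracket {f : M → ℝ} (hf : SmoothFun (n := n) f) {X Y : VField n M}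
    (hX : SmoothField X) (hY : SmoothField Y) (x : M) :
    d f x (mlieBracket (𝓡 n) X Y x) =
      d (fun y ↦ d f y (Y y)) x (X x) - d (fun y ↦ d f y (X y)) x (Y x) := by
  set φ := extChartAt (𝓡 n) x with hφ_def
  have : IsManifold (𝓡 n) 2 M := .of_le (n := ∞) two_le_infty
  have hx : x ∈ φ.source := mem_extChartAt_source x
  rw [d_apply_eq_fderiv hx (((smoothOneForm_d hf).apply hY).mdiff x) X,
    d_apply_eq_fderiv hx (((smoothOneForm_d hf).apply hX).mdiff x) Y]
  set X' := mpullbackWithin 𝓘(ℝ, EuclideanSpace ℝ (Fin n)) (𝓡 n) φ.symm X (Set.range (𝓡 n))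
    with hX'
  set Y' := mpullbackWithin 𝓘(ℝ, EuclideanSpace ℝ (Fin n)) (𝓡 n) φ.symm Y (Set.range (𝓡 n))
    with hY'
  have hr : Set.range (𝓡 n) = Set.univ := by simp
  have hev : ∀ᶠ u in 𝓝 (φ x), u ∈ φ.target := extChartAt_target_mem_nhds x
  have key (Z : VField n M) : ((fun y ↦ d f y (Z y)) ∘ φ.symm) =ᶠ[𝓝 (φ x)]
      fun u ↦ fderiv ℝ (f ∘ φ.symm) u
        (mpullbackWithin 𝓘(ℝ, EuclideanSpace ℝ (Fin n)) (𝓡 n) φ.symm Z (Set.range (𝓡 n)) u) := by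
    filter_upwards [hev] with u hu
    have := d_apply_eq_fderiv (φ.map_target hu) (hf.mdiff _) Z
    simp only [Function.comp_apply, this]
    rw [← hφ_def, φ.right_inv hu]
  rw [(key X).fderiv_eq, (key Y).fderiv_eq]
  have hXd : DifferentiableAt ℝ X' (φ x) := by
    have := ((hX x).mdifferentiableAt
      (by simp)).mdifferentiableWithinAt.differentiableWithinAt_mpullbackWithin_vectorField
        (s := Set.univ)
    exact this.differentiableAt (by simp)
  have hYd : DifferentiableAt ℝ Y' (φ x) := by
    have := ((hY x).mdifferentiableAt
      (by simp)).mdifferentiableWithinAt.differentiableWithinAt_mpullbackWithin_vectorField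
        (s := Set.univ)
    exact this.differentiableAt (by simp)
  have hfd : ContDiffAt ℝ ∞ (f ∘ φ.symm) (φ x) := by
    have h1 := (contMDiffAt_iff.1 (hf x)).2
    rw [hr] at h1
    exact h1
  rw [← fderiv_apply_lieBracket hfd (by simpa using two_le_infty) hYd hXd]
  have hφ : MDifferentiableAt (𝓡 n) 𝓘(ℝ, EuclideanSpace ℝ (Fin n)) φ x :=
    mdifferentiableAt_extChartAt (mem_chart_source _ x)
  have hfφ : MDifferentiableAt 𝓘(ℝ, EuclideanSpace ℝ (Fin n)) 𝓘(ℝ, ℝ) (f ∘ φ.symm) (φ x) :=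
    (hfd.differentiableAt (by simp)).mdifferentiableAt
  have hfeq : f =ᶠ[𝓝 x] (f ∘ φ.symm) ∘ φ := by
    filter_upwards [extChartAt_source_mem_nhds (I := 𝓡 n) x] with y hy
    simp [φ.left_inv hy]
  have hinv := isInvertible_mfderiv_extChartAt (I := 𝓡 n) (mem_extChartAt_source (I := 𝓡 n) x)
  have h1 := mfderiv_comp_apply x hfφ hφ (mlieBracket (𝓡 n) X Y x)
  rw [mfderiv_eq_fderiv, ← hfeq.mfderiv_eq] at h1
  refine h1.trans ?_
  congr 1
  have hu : φ.symm ⁻¹' Set.univ ∩ Set.range (𝓡 n) = Set.univ := by rw [hr]; simp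
  refine (hinv.self_apply_inverse _).trans ?_
  change lieBracketWithin ℝ X' Y' (φ.symm ⁻¹' Set.univ ∩ Set.range (𝓡 n)) (φ x) = _
  rw [hu]
  exact congrFun lieBracketWithin_univ (φ x)

end

/-! ### Coordinate frames -/

section

variable {n : ℕ} {M : Type*} [TopologicalSpace M]
  [ChartedSpace (EuclideanSpace ℝ (Fin n)) M] [IsManifold (𝓡 n) ∞ M]

/-- A coordinate frame on the open set `U`: globally defined smooth functions `q i` and smooth
vector fields `e j` on `M` such that `dqⁱ(e_j) = δⁱ_j` on `U`. The functions `q i` are then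
local coordinates at every point of `U`, and the `e j` are the coordinate fields. -/
structure IsCoordFrame (q : Fin n → M → ℝ) (e : Fin n → VField n M) (U : Set M) : Prop where
  isOpen : IsOpen U
  smooth_fun : ∀ i, SmoothFun (n := n) (q i)
  smooth_field : ∀ i, SmoothField (e i)
  dual : ∀ y ∈ U, ∀ i j, d (q i) y (e j y) = if i = j then 1 else 0

/-- The coordinates of the chart at `p` and the local frame given by the trivialization of the
tangent bundle at `p`, both cut off by a bump function that equals `1` near `p`. -/
theorem exists_isCoordFrame [T2Space M] (p : M) :
    ∃ (q : Fin n → M → ℝ) (e : Fin n → VField n M) (U : Set M), p ∈ U ∧ IsCoordFrame q e U := by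
  obtain ⟨ρ⟩ : Nonempty (SmoothBumpFunction (𝓡 n) p) := inferInstance
  let T := trivializationAt (EuclideanSpace ℝ (Fin n)) (TangentSpace (𝓡 n)) p
  let b := (EuclideanSpace.basisFun (Fin n) ℝ).toBasis
  have hT : T.baseSet = (chartAt (EuclideanSpace ℝ (Fin n)) p).source := rfl
  refine ⟨fun i y ↦ ρ y • (extChartAt (𝓡 n) p y) i, fun i ↦ (ρ : M → ℝ) • T.localFrame b i,
    interior {y | ρ y = 1} ∩ (chartAt (EuclideanSpace ℝ (Fin n)) p).source,
    ⟨?_, ?_⟩, ?_, ?_, ?_, ?_⟩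
  · exact mem_interior_iff_mem_nhds.2 ρ.eventuallyEq_one
  · exact mem_chart_source _ p
  · exact isOpen_interior.inter (chartAt _ p).open_source
  · intro i
    refine ρ.contMDiff_smul ?_
    exact (EuclideanSpace.proj (𝕜 := ℝ) i).contMDiff.comp_contMDiffOn (contMDiffOn_extChartAt)
  · intro i
    refine ContMDiffOn.smul_section_of_tsupport (u := T.baseSet) ρ.contMDiff.contMDiffOn
      T.open_baseSet ?_ ?_
    · rw [hT]; exact ρ.tsupport_subset_chartAt_source
    · exact T.contMDiffOn_localFrame_baseSet _ b i
  · rintro y ⟨hy1, hy2⟩ i j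
    have hq : (fun z ↦ ρ z • (extChartAt (𝓡 n) p z) i) =ᶠ[𝓝 y]
        (EuclideanSpace.proj (𝕜 := ℝ) i) ∘ extChartAt (𝓡 n) p := by
      filter_upwards [mem_interior_iff_mem_nhds.1 hy1] with z hz
      have hz' : ρ z = 1 := hz
      simp [hz']
    have hy3 : y ∈ T.baseSet := hy2
    have hρ : ρ y = 1 := by simpa using interior_subset (s := {y | ρ y = 1}) hy1
    have he : ((ρ : M → ℝ) • T.localFrame b j) y = T.symmL ℝ y (b j) := by
      simp [hρ, T.localFrame_apply_of_mem_baseSet b hy3, Trivialization.basisAt]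
      exact (T.symmL_apply (hb := hy3) (b j)).symm
    have h1 := mfderiv_comp_apply y ((EuclideanSpace.proj (𝕜 := ℝ) i).mdifferentiableAt)
      (mdifferentiableAt_extChartAt (I := 𝓡 n) hy2) (T.symmL ℝ y (b j))
    rw [← hq.mfderiv_eq, ← TangentBundle.continuousLinearMapAt_trivializationAt hy2] at h1
    rw [he]
    refine h1.trans ?_
    rw [ContinuousLinearMap.mfderiv_eq]
    refine (congrArg (EuclideanSpace.proj (𝕜 := ℝ) i)
      (T.continuousLinearMapAt_symmL hy3 (b j))).trans ?_
    simp [b, EuclideanSpace.basisFun_apply]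

namespace IsCoordFrame

variable {q : Fin n → M → ℝ} {e : Fin n → VField n M} {U : Set M} (hF : IsCoordFrame q e U)
  {y : M} (hy : y ∈ U)
include hF hy

theorem linearIndependent : LinearIndependent ℝ (fun i ↦ e i y) := by
  rw [Fintype.linearIndependent_iff]
  intro g hg i
  have := congrArg (d (q i) y) hg
  simpa [hF.dual y hy] using this

theorem sum_smul (v : TangentSpace (𝓡 n) y) : ∑ i, d (q i) y v • e i y = v := by
  have : FiniteDimensional ℝ (TangentSpace (𝓡 n) y) :=
    inferInstanceAs (FiniteDimensional ℝ (EuclideanSpace ℝ (Fin n)))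
  have hc : Fintype.card (Fin n) = Module.finrank ℝ (TangentSpace (𝓡 n) y) := by
    change _ = Module.finrank ℝ (EuclideanSpace ℝ (Fin n))
    simp
  obtain ⟨c, hc⟩ : ∃ c : Fin n → ℝ, ∑ i, c i • e i y = v := by
    have := (hF.linearIndependent hy).span_eq_top_of_card_eq_finrank' hc
    exact (Submodule.mem_span_range_iff_exists_fun ℝ).1 (this ▸ Submodule.mem_top)
  subst hc
  simp [hF.dual y hy]

/-- The basis of the tangent space at `y` given by a coordinate frame. -/
def basis : Module.Basis (Fin n) ℝ (TangentSpace (𝓡 n) y) :=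
  .mk (hF.linearIndependent hy) (by
    rintro v -
    exact (Submodule.mem_span_range_iff_exists_fun ℝ).2 ⟨_, hF.sum_smul hy v⟩)

theorem basis_apply (i : Fin n) : hF.basis hy i = e i y := by simp [basis]

theorem basis_repr (v : TangentSpace (𝓡 n) y) (i : Fin n) :
    (hF.basis hy).repr v i = d (q i) y v := by
  conv_lhs => rw [← hF.sum_smul hy v]
  simp [← hF.basis_apply hy, Finsupp.single_apply]

end IsCoordFrame

end

/-! ### The compatibility condition on differentials of functions -/

section

variable {n : ℕ} {M : Type*} [TopologicalSpace M]
  [ChartedSpace (EuclideanSpace ℝ (Fin n)) M] [IsManifold (𝓡 n) ∞ M]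

theorem SmoothEnd.apply_pow {N : EndField n M} {X : VField n M} (hN : SmoothEnd N)
    (hX : SmoothField X) (k : ℕ) : SmoothField (fun x ↦ (N x ^ k) (X x)) := by
  induction k with
  | zero => simpa using hX
  | succ k ih =>
    simp only [pow_succ']
    exact hN.apply ih

/-- `L_X(df) = d(X f)`. -/
theorem lieOneForm_d {f : M → ℝ} (hf : SmoothFun (n := n) f) {X Z : VField n M}
    (hX : SmoothField X) (hZ : SmoothField Z) (x : M) :
    lieOneForm X (d f) Z x = d (fun y ↦ d f y (X y)) x (Z x) := by
  rw [lieOneForm, d_mlieBracket hf hX hZ, sub_sub_cancel]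

namespace IsPoissonNijenhuis

variable {P : BiField n M} {N : EndField n M} (hPN : IsPoissonNijenhuis P N)
include hPN

/-- `N^k P = P (Nᵗ)^k`. -/
theorem comm_pow (k : ℕ) (x : M) (α : TangentSpace (𝓡 n) x →L[ℝ] ℝ) :
    (N x ^ k) (P x α) = P x (α.comp (N x ^ k)) := by
  induction k generalizing α with
  | zero => simp [ContinuousLinearMap.one_def]
  | succ k ih =>
    rw [pow_succ, mul_apply_eq_comp, hPN.comm, ih]
    congr 1
    rw [← pow_succ, pow_succ']
    rfl

theorem iterBi_skew (k : ℕ) (x : M) (α β : TangentSpace (𝓡 n) x →L[ℝ] ℝ) :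
    β (iterBi N P k x α) = -α (iterBi N P k x β) := by
  change β ((N x ^ k) (P x α)) = -α ((N x ^ k) (P x β))
  rw [hPN.comm_pow k x β, ← hPN.poisson.skew, ContinuousLinearMap.comp_apply]

theorem smoothField_iterBi (k : ℕ) {f : M → ℝ} (hf : SmoothFun (n := n) f) :
    SmoothField (hamiltonian (iterBi N P k) f) :=
  hPN.nijenhuis.smooth.apply_pow (hPN.poisson.smooth.apply (smoothOneForm_d hf)) k

theorem smoothField_hamiltonian {f : M → ℝ} (hf : SmoothFun (n := n) f) :
    SmoothField (hamiltonian P f) := hPN.poisson.smooth.apply (smoothOneForm_d hf)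

/-- The compatibility condition for `α = df` and `β = dg`. The left side appears because
`[df, dg]_Q = d{f, g}_Q`, which also gives the last term on the right. -/
theorem d_bracket_iterBi_one {f g : M → ℝ} (hf : SmoothFun (n := n) f)
    (hg : SmoothFun (n := n) g) {Z : VField n M} (hZ : SmoothField Z) (x : M) :
    d (bracket (iterBi N P 1) f g) x (Z x) =
      - d (fun y ↦ d f y (N y (Z y))) x (hamiltonian P g x)
      + d f x (N x (mlieBracket (𝓡 n) (hamiltonian P g) Z x))
      + d (fun y ↦ d g y (N y (Z y))) x (hamiltonian P f x)
      - d g x (N x (mlieBracket (𝓡 n) (hamiltonian P f) Z x))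
      - d (bracket P f g) x (N x (Z x)) := by
  have hNZ := hPN.nijenhuis.smooth.apply hZ
  have h1f := hPN.smoothField_iterBi 1 hf
  have h1g := hPN.smoothField_iterBi 1 hg
  have hHf := hPN.smoothField_hamiltonian hf
  have hHg := hPN.smoothField_hamiltonian hg
  have hNP (h : M → ℝ) : (fun y ↦ P y (applyForm N (d h) y)) = hamiltonian (iterBi N P 1) h := by
    funext y
    simp [applyForm, hamiltonian, iterBi, hPN.comm]
  have hsymm : (fun y ↦ d f y (hamiltonian (iterBi N P 1) g y)) =
      fun y ↦ -bracket (iterBi N P 1) f g y := by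
    funext y
    rw [bracket, hamiltonian, hamiltonian, hPN.iterBi_skew 1]
  have h1 : koszulBracket (iterBi N P 1) (d f) (d g) Z x =
      d (bracket (iterBi N P 1) f g) x (Z x) := by
    change lieOneForm (hamiltonian (iterBi N P 1) f) (d g) Z x
      - lieOneForm (hamiltonian (iterBi N P 1) g) (d f) Z x
      - d (bracket (iterBi N P 1) f g) x (Z x) = _
    rw [lieOneForm_d hg h1f hZ, lieOneForm_d hf h1g hZ, hsymm, d_neg]
    rw [_root_.neg_apply, sub_neg_eq_add, add_sub_cancel_right]
    rfl
  have h2 : koszulBracket P (applyForm N (d f)) (d g) Z x =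
      - d (fun y ↦ d f y (N y (Z y))) x (hamiltonian P g x)
      + d f x (N x (mlieBracket (𝓡 n) (hamiltonian P g) Z x)) := by
    change lieOneForm (fun y ↦ P y (applyForm N (d f) y)) (d g) Z x
      - (d (fun y ↦ d f y (N y (Z y))) x (hamiltonian P g x)
        - d f x (N x (mlieBracket (𝓡 n) (hamiltonian P g) Z x)))
      - d (fun y ↦ d g y ((fun z ↦ P z (applyForm N (d f) z)) y)) x (Z x) = _
    rw [hNP, lieOneForm_d hg h1f hZ]
    ring
  have h3 : koszulBracket P (d f) (applyForm N (d g)) Z x =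
      d (fun y ↦ d g y (N y (Z y))) x (hamiltonian P f x)
      - d g x (N x (mlieBracket (𝓡 n) (hamiltonian P f) Z x)) := by
    change (d (fun y ↦ d g y (N y (Z y))) x (hamiltonian P f x)
        - d g x (N x (mlieBracket (𝓡 n) (hamiltonian P f) Z x)))
      - lieOneForm (fun y ↦ P y (applyForm N (d g) y)) (d f) Z x
      - d (bracket (iterBi N P 1) f g) x (Z x) = _
    rw [hNP, lieOneForm_d hf h1g hZ, hsymm, d_neg]
    simp
  have h4 : koszulBracket P (d f) (d g) (applyField N Z) x =
      d (bracket P f g) x (N x (Z x)) := by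
    change lieOneForm (hamiltonian P f) (d g) (applyField N Z) x
      - lieOneForm (hamiltonian P g) (d f) (applyField N Z) x
      - d (bracket P f g) x (N x (Z x)) = _
    have hs : (fun y ↦ d f y (hamiltonian P g y)) = fun y ↦ -bracket P f g y := by
      funext y
      rw [bracket, hamiltonian, hamiltonian, hPN.poisson.skew]
    rw [lieOneForm_d hg hHf hNZ, lieOneForm_d hf hHg hNZ, hs, d_neg]
    rw [_root_.neg_apply, sub_neg_eq_add]
    exact add_sub_cancel_right _ _
  have hc := hPN.compat (d f) (d g) Z (smoothOneForm_d hf) (smoothOneForm_d hg) hZ x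
  rw [h1, h2, h3, h4] at hc
  linarith

end IsPoissonNijenhuis

end

/-! ### Matrices of tensors in a coordinate frame -/

section

section MatrixCalculus

variable {n : ℕ} {M : Type*} [TopologicalSpace M]
  [ChartedSpace (EuclideanSpace ℝ (Fin n)) M]

/-- A matrix-valued function is smooth if its entries are. -/
def SmoothMat (F : M → Matrix (Fin n) (Fin n) ℝ) : Prop :=
  ∀ i j, SmoothFun (n := n) (fun y ↦ F y i j)

/-- The entrywise derivative of a matrix-valued function in the direction of a tangent vector. -/
def matDeriv (F : M → Matrix (Fin n) (Fin n) ℝ) (x : M) (v : TangentSpace (𝓡 n) x) :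
    Matrix (Fin n) (Fin n) ℝ := Matrix.of fun i j ↦ d (fun y ↦ F y i j) x v

variable {F G : M → Matrix (Fin n) (Fin n) ℝ} {x : M} {v : TangentSpace (𝓡 n) x}

theorem matDeriv_apply (i j : Fin n) : matDeriv F x v i j = d (fun y ↦ F y i j) x v := rfl

theorem matDeriv_congr (h : F =ᶠ[𝓝 x] G) : matDeriv F x v = matDeriv G x v := by
  ext i j
  rw [matDeriv_apply, matDeriv_apply, d_congr (h.mono fun y hy ↦ by rw [hy])]

theorem SmoothMat.mul (hF : SmoothMat F) (hG : SmoothMat G) : SmoothMat (fun y ↦ F y * G y) := by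
  intro i j
  simp only [Matrix.mul_apply]
  exact SmoothFun.sum fun a _ ↦ (hF i a).mul (hG a j)

theorem SmoothMat.pow (hF : SmoothMat F) (k : ℕ) : SmoothMat (fun y ↦ F y ^ k) := by
  induction k with
  | zero => intro i j; simpa using smoothFun_const _
  | succ k ih => simpa only [pow_succ] using ih.mul hF

theorem SmoothMat.transpose (hF : SmoothMat F) : SmoothMat (fun y ↦ (F y)ᵀ) := fun i j ↦ hF j i

theorem SmoothMat.trace (hF : SmoothMat F) : SmoothFun (n := n) (fun y ↦ (F y).trace) :=
  SmoothFun.sum fun i _ ↦ hF i i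

theorem matDeriv_transpose : matDeriv (fun y ↦ (F y)ᵀ) x v = (matDeriv F x v)ᵀ := rfl

theorem matDeriv_mul (hF : SmoothMat F) (hG : SmoothMat G) :
    matDeriv (fun y ↦ F y * G y) x v = matDeriv F x v * G x + F x * matDeriv G x v := by
  ext i j
  simp only [matDeriv_apply, Matrix.add_apply, Matrix.mul_apply]
  rw [SmoothFun.d_sum fun a _ ↦ (hF i a).mul (hG a j), ← Finset.sum_add_distrib,
    _root_.sum_apply]
  refine Finset.sum_congr rfl fun a _ ↦ ?_
  rw [SmoothFun.d_mul (hF i a) (hG a j)]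
  simp only [_root_.add_apply, _root_.smul_apply, smul_eq_mul]
  ring

theorem d_trace (hF : SmoothMat F) :
    d (fun y ↦ (F y).trace) x v = (matDeriv F x v).trace := by
  simp only [Matrix.trace, Matrix.diag_apply]
  rw [SmoothFun.d_sum fun i _ ↦ hF i i, _root_.sum_apply]
  rfl

/-- `Tr(F^m D(F^{k+1})) = (k + 1) Tr(F^{m+k} DF)`. The extra factor `F^m` makes the induction on `k`
work, as `F` and `DF` need not commute. -/
theorem trace_pow_mul_matDeriv_pow (hF : SmoothMat F) (k m : ℕ) :
    (F x ^ m * matDeriv (fun y ↦ F y ^ (k + 1)) x v).trace =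
      (k + 1) * (F x ^ (m + k) * matDeriv F x v).trace := by
  induction k generalizing m with
  | zero => simp
  | succ k ih =>
    have h := matDeriv_mul (x := x) (v := v) (hF.pow (k + 1)) hF
    simp only [← pow_succ] at h
    rw [h, mul_add, Matrix.trace_add, ← mul_assoc, Matrix.trace_mul_comm, ← mul_assoc, ← pow_succ',
      ih, ← mul_assoc, ← pow_add]
    push_cast
    rw [add_right_comm m 1 k]
    ring_nf

theorem d_trace_pow (hF : SmoothMat F) (k : ℕ) :
    d (fun y ↦ (F y ^ (k + 1)).trace) x v = (k + 1) * (F x ^ k * matDeriv F x v).trace := by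
  rw [d_trace (hF.pow _)]
  simpa using trace_pow_mul_matDeriv_pow (x := x) (v := v) hF k 0

end MatrixCalculus

variable {n : ℕ} {M : Type*} [TopologicalSpace M]
  [ChartedSpace (EuclideanSpace ℝ (Fin n)) M] [IsManifold (𝓡 n) ∞ M]

/-- The matrix of a (1,1)-tensor in a coordinate frame, with entries `Nⁱ_a = dqⁱ(N e_a)`. -/
def endMat (q : Fin n → M → ℝ) (e : Fin n → VField n M) (N : EndField n M) (y : M) :
    Matrix (Fin n) (Fin n) ℝ := Matrix.of fun i a ↦ d (q i) y (N y (e a y))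

/-- The matrix of a contravariant 2-tensor in coordinates, `P^{ij} = P(dqⁱ, dqʲ)`. -/
def biMat (q : Fin n → M → ℝ) (P : BiField n M) (y : M) :
    Matrix (Fin n) (Fin n) ℝ := Matrix.of fun i j ↦ d (q j) y (P y (d (q i) y))

namespace IsCoordFrame

variable {q : Fin n → M → ℝ} {e : Fin n → VField n M} {U : Set M} (hF : IsCoordFrame q e U)
include hF

theorem smoothMat_endMat {N : EndField n M} (hN : SmoothEnd N) : SmoothMat (endMat q e N) :=
  fun i a ↦ (smoothOneForm_d (hF.smooth_fun i)).apply (hN.apply (hF.smooth_field a))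

theorem smoothMat_biMat {P : BiField n M}
    (hP : ∀ f, SmoothFun (n := n) f → SmoothField (hamiltonian P f)) :
    SmoothMat (n := n) (biMat q P) :=
  fun i j ↦ (smoothOneForm_d (hF.smooth_fun j)).apply (hP _ (hF.smooth_fun i))

variable {y : M} (hy : y ∈ U)
include hy

theorem eventually_mem : ∀ᶠ z in 𝓝 y, z ∈ U := hF.isOpen.mem_nhds hy

theorem ext {v w : TangentSpace (𝓡 n) y} (h : ∀ i, d (q i) y v = d (q i) y w) : v = w := by
  rw [← hF.sum_smul hy v, ← hF.sum_smul hy w]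
  simp [h]

/-- A covector expands as `α = ∑ α(e_i) dqⁱ`. -/
theorem apply_eq_sum (α : TangentSpace (𝓡 n) y →L[ℝ] ℝ) (v : TangentSpace (𝓡 n) y) :
    α v = ∑ i, d (q i) y v * α (e i y) := by
  conv_lhs => rw [← hF.sum_smul hy v]
  simp

theorem endMat_eq_toMatrix (N : EndField n M) :
    endMat q e N y = LinearMap.toMatrix (hF.basis hy) (hF.basis hy) (N y).toLinearMap := by
  ext i a
  rw [LinearMap.toMatrix_apply, hF.basis_apply hy, hF.basis_repr hy]
  rfl

theorem endMat_pow (N : EndField n M) (k : ℕ) :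
    endMat q e (fun z ↦ N z ^ k) y = endMat q e N y ^ k := by
  have h : ((N y ^ k : _ →L[ℝ] _)).toLinearMap = (N y).toLinearMap ^ k :=
    map_pow ContinuousLinearMap.toLinearMapRingHom (N y) k
  rw [hF.endMat_eq_toMatrix hy, hF.endMat_eq_toMatrix hy, h]
  exact (LinearMap.toMatrix_pow (hF.basis hy) (N y).toLinearMap k).symm

theorem trace_pow (N : EndField n M) (k : ℕ) :
    LinearMap.trace ℝ (TangentSpace (𝓡 n) y) ((N y) ^ k : _ →L[ℝ] _).toLinearMap =
      (endMat q e N y ^ k).trace := by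
  rw [← hF.endMat_pow hy, hF.endMat_eq_toMatrix hy, LinearMap.trace_eq_matrix_trace ℝ (hF.basis hy)]

theorem d_apply_end (N : EndField n M) (i : Fin n) (v : TangentSpace (𝓡 n) y) :
    d (q i) y (N y v) = ∑ a, endMat q e N y i a * d (q a) y v := by
  rw [← ContinuousLinearMap.comp_apply, hF.apply_eq_sum hy]
  exact Finset.sum_congr rfl fun a _ ↦ mul_comm _ _

theorem biMat_iterBi (N : EndField n M) (P : BiField n M) (k : ℕ) :
    biMat q (iterBi N P k) y = biMat q P y * (endMat q e N y ^ k)ᵀ := by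
  ext i j
  rw [← hF.endMat_pow hy, Matrix.mul_apply]
  refine (hF.d_apply_end hy (fun z ↦ N z ^ k) j (P y (d (q i) y))).trans ?_
  exact Finset.sum_congr rfl fun a _ ↦ mul_comm _ _

theorem d_d_apply_field (a k : Fin n) (v : TangentSpace (𝓡 n) y) :
    d (fun z ↦ d (q a) z (e k z)) y v = 0 := by
  have : (fun z ↦ d (q a) z (e k z)) =ᶠ[𝓝 y] fun _ ↦ if a = k then (1 : ℝ) else 0 := by
    filter_upwards [hF.eventually_mem hy] with z hz using hF.dual z hz a k
  rw [d_congr this, d_const]; rfl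

theorem d_mlieBracket_field {X : VField n M} (hX : SmoothField X) (a k : Fin n) :
    d (q a) y (mlieBracket (𝓡 n) X (e k) y) = -d (fun z ↦ d (q a) z (X z)) y (e k y) := by
  rw [d_mlieBracket (hF.smooth_fun a) hX (hF.smooth_field k), hF.d_d_apply_field hy, zero_sub]

theorem mlieBracket_field_field (j k : Fin n) : mlieBracket (𝓡 n) (e j) (e k) y = 0 := by
  refine hF.ext hy fun a ↦ ?_
  rw [hF.d_mlieBracket_field hy (hF.smooth_field j), hF.d_d_apply_field hy]
  simp

end IsCoordFrame

end

/-! ### Compatibility and torsion in components -/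

section

/-- The compatibility condition `hc` in components, contracted with a matrix `S` that commutes
with `N`; it is applied to `S = N^k`. Here `DN k` and `DP k` are the partial derivatives of `N`
and `P`. -/
theorem sum_two_mul_of_compat {n : ℕ} {N P S : Matrix (Fin n) (Fin n) ℝ}
    {DN DP : Fin n → Matrix (Fin n) (Fin n) ℝ} (hDP : ∀ k, (DP k)ᵀ = -DP k)
    (hSN : S * N = N * S) (hSP : S * P = P * Sᵀ)
    (hNP : ∀ k, DN k * P + N * DP k = DP k * Nᵀ + P * (DN k)ᵀ)
    (hc : ∀ i j k, (DP k * Nᵀ + P * (DN k)ᵀ) i j =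
      -∑ a, P j a * DN a i k - ∑ a, N i a * DP k j a + ∑ a, P i a * DN a j k
        + ∑ a, N j a * DP k i a - ∑ a, N a k * DP a i j) (i : Fin n) :
    2 * ∑ k, ∑ a, DN k i a * (P * Sᵀ) a k = ∑ a, P i a * (S * DN a).trace := by
  have hskew (k i j) : DP k i j = -DP k j i := by
    simpa using congrFun (congrFun (hDP k) j) i
  -- the derivative of `N P = P Nᵀ` leaves only two terms with derivatives of `P`
  have h1 (j k) : (DN k * P) i j = -∑ a, P j a * DN a i k + ∑ a, P i a * DN a j k
      + ∑ a, N j a * DP k i a - ∑ a, N a k * DP a i j := by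
    have h2 := congrFun (congrFun (hNP k) i) j
    have h3 : (N * DP k) i j = -∑ a, N i a * DP k j a := by
      rw [Matrix.mul_apply, ← Finset.sum_neg_distrib]
      exact Finset.sum_congr rfl fun a _ ↦ by rw [hskew k a j]; ring
    have h4 := hc i j k
    have h5 : (DP k * Nᵀ) i j = ∑ a, N j a * DP k i a := by
      rw [Matrix.mul_apply]
      exact Finset.sum_congr rfl fun a _ ↦ mul_comm _ _
    rw [Matrix.add_apply, Matrix.add_apply] at h2
    rw [Matrix.add_apply] at h4
    linarith
  have h6 : ∑ k, ∑ j, S k j * (DN k * P) i j = ∑ k, ∑ a, DN k i a * (P * Sᵀ) a k := by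
    refine Finset.sum_congr rfl fun k _ ↦ ?_
    simp only [Matrix.mul_apply, Finset.mul_sum, Matrix.transpose_apply]
    rw [Finset.sum_comm]
    exact Finset.sum_congr rfl fun a _ ↦ Finset.sum_congr rfl fun j _ ↦ by ring
  have h7 : ∑ k, ∑ j, S k j * ∑ a, P j a * DN a i k = ∑ k, ∑ a, DN k i a * (P * Sᵀ) a k := by
    rw [← hSP]
    simp only [Matrix.mul_apply, Finset.mul_sum]
    rw [Finset.sum_congr rfl fun k _ ↦ Finset.sum_comm, Finset.sum_comm]
    exact Finset.sum_congr rfl fun a _ ↦ Finset.sum_congr rfl fun k _ ↦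
      Finset.sum_congr rfl fun j _ ↦ by ring
  have h8 : ∑ k, ∑ j, S k j * ∑ a, P i a * DN a j k = ∑ a, P i a * (S * DN a).trace := by
    simp only [Matrix.trace, Matrix.diag_apply, Matrix.mul_apply, Finset.mul_sum]
    rw [Finset.sum_congr rfl fun k _ ↦ Finset.sum_comm, Finset.sum_comm]
    exact Finset.sum_congr rfl fun a _ ↦ Finset.sum_congr rfl fun k _ ↦
      Finset.sum_congr rfl fun j _ ↦ by ring
  -- the terms with derivatives of `P` cancel because `S` and `N` commute
  have h9 : ∑ k, ∑ j, S k j * ∑ a, N j a * DP k i a = ∑ k, ∑ j, S k j * ∑ a, N a k * DP a i j := by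
    have h10 : ∑ k, ∑ a, (S * N) k a * DP k i a = ∑ a, ∑ j, (N * S) a j * DP a i j := by rw [hSN]
    simp only [Matrix.mul_apply, Finset.sum_mul, mul_assoc] at h10
    simp only [Finset.mul_sum]
    rw [Finset.sum_congr rfl fun k _ ↦ Finset.sum_comm, h10,
      Finset.sum_congr rfl fun a _ ↦ Finset.sum_comm, Finset.sum_comm]
    refine Finset.sum_congr rfl fun k _ ↦ ?_
    rw [Finset.sum_comm]
    exact Finset.sum_congr rfl fun a _ ↦ Finset.sum_congr rfl fun j _ ↦ by ring
  simp only [h1, mul_add, mul_sub, mul_neg, Finset.sum_add_distrib, Finset.sum_sub_distrib,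
    Finset.sum_neg_distrib] at h6
  linarith

namespace IsCoordFrame

variable {n : ℕ} {M : Type*} [TopologicalSpace M]
  [ChartedSpace (EuclideanSpace ℝ (Fin n)) M] [IsManifold (𝓡 n) ∞ M]
  {q : Fin n → M → ℝ} {e : Fin n → VField n M} {U : Set M} (hF : IsCoordFrame q e U)
  {x : M} (hx : x ∈ U) {P : BiField n M} {N : EndField n M}
include hF hx

theorem compat_components (hPN : IsPoissonNijenhuis P N) (i j k : Fin n) :
    matDeriv (fun y ↦ biMat q P y * (endMat q e N y)ᵀ) x (e k x) i j =
      -∑ a, biMat q P x j a * matDeriv (endMat q e N) x (e a x) i k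
      - ∑ a, endMat q e N x i a * matDeriv (biMat q P) x (e k x) j a
      + ∑ a, biMat q P x i a * matDeriv (endMat q e N) x (e a x) j k
      + ∑ a, endMat q e N x j a * matDeriv (biMat q P) x (e k x) i a
      - ∑ a, endMat q e N x a k * matDeriv (biMat q P) x (e a x) i j := by
  have h := hPN.d_bracket_iterBi_one (hF.smooth_fun i) (hF.smooth_fun j) (hF.smooth_field k) x
  have hl : (fun y ↦ biMat q P y * (endMat q e N y)ᵀ) =ᶠ[𝓝 x] biMat q (iterBi N P 1) := by
    filter_upwards [hF.eventually_mem hx] with y hy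
    rw [hF.biMat_iterBi hy, pow_one]
  have hb (l m : Fin n) : d (q m) x (N x (mlieBracket (𝓡 n) (hamiltonian P (q l)) (e k) x)) =
      -∑ a, endMat q e N x m a * matDeriv (biMat q P) x (e k x) l a := by
    rw [hF.d_apply_end hx, ← Finset.sum_neg_distrib]
    refine Finset.sum_congr rfl fun a _ ↦ ?_
    rw [hF.d_mlieBracket_field hx (hPN.smoothField_hamiltonian (hF.smooth_fun l)), mul_neg]
    rfl
  rw [matDeriv_congr hl]
  refine h.trans ?_
  rw [hb, hb, hF.apply_eq_sum hx (d (fun y ↦ d (q i) y (N y (e k y))) x),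
    hF.apply_eq_sum hx (d (fun y ↦ d (q j) y (N y (e k y))) x),
    hF.apply_eq_sum hx (d (bracket P (q i) (q j)) x)]
  simp only [sub_eq_add_neg, neg_neg]
  rfl

theorem torsion_components (hN : IsNijenhuis N) (i a b : Fin n) :
    ∑ c, endMat q e N x c a * matDeriv (endMat q e N) x (e c x) i b
      - ∑ c, endMat q e N x c b * matDeriv (endMat q e N) x (e c x) i a
      + ∑ c, endMat q e N x i c * matDeriv (endMat q e N) x (e b x) c a
      - ∑ c, endMat q e N x i c * matDeriv (endMat q e N) x (e a x) c b = 0 := by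
  have hs (a : Fin n) := hN.smooth.apply (hF.smooth_field a)
  have h := congrArg (d (q i) x)
    (hN.torsion (e a) (e b) (hF.smooth_field a) (hF.smooth_field b) x)
  rw [hF.mlieBracket_field_field hx, map_zero, map_zero, add_zero, map_sub, map_sub, map_zero,
    d_mlieBracket (hF.smooth_fun i) (hs a) (hs b), hF.d_apply_end hx, hF.d_apply_end hx] at h
  have hb (a b c : Fin n) : d (q c) x (mlieBracket (𝓡 n) (applyField N (e a)) (e b) x) =
      -matDeriv (endMat q e N) x (e b x) c a := hF.d_mlieBracket_field hx (hs a) c b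
  have hb' (c : Fin n) : d (q c) x (mlieBracket (𝓡 n) (e a) (applyField N (e b)) x) =
      matDeriv (endMat q e N) x (e a x) c b := by
    rw [mlieBracket_swap_apply, map_neg, hb, neg_neg]
  simp only [hb, hb', mul_neg, Finset.sum_neg_distrib, sub_neg_eq_add] at h
  rw [hF.apply_eq_sum hx (d (fun y ↦ d (q i) y (applyField N (e b) y)) x),
    hF.apply_eq_sum hx (d (fun y ↦ d (q i) y (applyField N (e a) y)) x)] at h
  exact h

end IsCoordFrame

end

/-! ### Lie derivatives of volume forms -/

section

section Determinant

variable {n : ℕ} {M : Type*} [TopologicalSpace M]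
  [ChartedSpace (EuclideanSpace ℝ (Fin n)) M]

theorem SmoothFun.prod {ι : Type*} {s : Finset ι} {f : ι → M → ℝ}
    (hf : ∀ i ∈ s, SmoothFun (n := n) (f i)) : SmoothFun (n := n) (fun y ↦ ∏ i ∈ s, f i y) :=
  contMDiff_finsetProd hf

theorem SmoothFun.d_prod {ι : Type*} [DecidableEq ι] {s : Finset ι} {f : ι → M → ℝ}
    (hf : ∀ i ∈ s, SmoothFun (n := n) (f i)) (x : M) :
    d (n := n) (fun y ↦ ∏ i ∈ s, f i y) x =
      ∑ i ∈ s, (∏ j ∈ s.erase i, f j x) • d (f i) x := by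
  induction s using Finset.induction_on with
  | empty => simpa using d_const 1 x
  | insert a s ha ih =>
    have hs := fun i hi ↦ hf i (Finset.mem_insert_of_mem hi)
    simp only [Finset.prod_insert ha]
    rw [SmoothFun.d_mul (hf a (Finset.mem_insert_self a s)) (SmoothFun.prod hs), ih hs,
      Finset.sum_insert ha, Finset.erase_insert ha, add_comm, Finset.smul_sum]
    congr 1
    refine Finset.sum_congr rfl fun i hi ↦ ?_
    have hia : a ≠ i := fun h ↦ ha (h ▸ hi)
    rw [Finset.erase_insert_of_ne hia, Finset.prod_insert (by simp [ha]), smul_smul]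

/-- The derivative of a determinant, column by column. -/
theorem d_det {F : M → Matrix (Fin n) (Fin n) ℝ} (hF : SmoothMat F) (x : M)
    (v : TangentSpace (𝓡 n) x) : d (fun y ↦ (F y).det) x v =
      ∑ i, (F x).cramer (fun a ↦ matDeriv F x v a i) i := by
  simp only [Matrix.cramer_apply, Matrix.det_apply']
  have hp (σ : Equiv.Perm (Fin n)) : SmoothFun (n := n) fun y ↦ ∏ i, F y (σ i) i :=
    SmoothFun.prod fun i _ ↦ hF _ _
  rw [SmoothFun.d_sum fun σ _ ↦ (smoothFun_const _).mul (hp σ), Finset.sum_comm,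
    _root_.sum_apply]
  refine Finset.sum_congr rfl fun σ _ ↦ ?_
  rw [SmoothFun.d_mul (smoothFun_const _) (hp σ), d_const, SmoothFun.d_prod fun i _ ↦ hF _ _,
    smul_zero, add_zero, _root_.smul_apply, _root_.sum_apply, smul_eq_mul, Finset.mul_sum]
  refine Finset.sum_congr rfl fun i _ ↦ ?_
  have key : ∏ j ∈ Finset.univ.erase i, (F x).updateCol i (fun a ↦ matDeriv F x v a i) (σ j) j =
      ∏ j ∈ Finset.univ.erase i, F x (σ j) j :=
    Finset.prod_congr rfl fun j hj ↦ by rw [Matrix.updateCol_ne (Finset.ne_of_mem_erase hj)]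
  rw [← Finset.mul_prod_erase _ _ (Finset.mem_univ i), Matrix.updateCol_self, key, matDeriv_apply,
    _root_.smul_apply, smul_eq_mul]
  ring

theorem SmoothMat.det {F : M → Matrix (Fin n) (Fin n) ℝ} (hF : SmoothMat F) :
    SmoothFun (n := n) (fun y ↦ (F y).det) := by
  simp only [Matrix.det_apply']
  have hp (σ : Equiv.Perm (Fin n)) : SmoothFun (n := n) fun y ↦ ∏ i, F y (σ i) i :=
    SmoothFun.prod fun i _ ↦ hF _ _
  exact SmoothFun.sum fun σ _ ↦ (smoothFun_const _).mul (hp σ)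

/-- `∑ i, det(A with column i replaced by that of B A) = det A · Tr B`. -/
theorem sum_cramer_mul (A B : Matrix (Fin n) (Fin n) ℝ) :
    ∑ i, A.cramer (fun a ↦ (B * A) a i) i = A.det * B.trace := by
  have : ∑ i, A.cramer (fun a ↦ (B * A) a i) i = (A.adjugate * (B * A)).trace := by
    simp only [Matrix.cramer_eq_adjugate_mulVec]
    rfl
  rw [this, Matrix.trace_mul_comm, Matrix.mul_assoc, Matrix.mul_adjugate]
  simp

end Determinant

namespace IsCoordFrame

variable {n : ℕ} {M : Type*} [TopologicalSpace M]
  [ChartedSpace (EuclideanSpace ℝ (Fin n)) M] [IsManifold (𝓡 n) ∞ M]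
  {q : Fin n → M → ℝ} {e : Fin n → VField n M} {U : Set M} (hF : IsCoordFrame q e U)
  {x : M} (hx : x ∈ U) {μ : TopForm n M}
include hF hx

/-- In a coordinate frame, `μ = ρ dq¹ ⋯ dqⁿ` with `ρ = μ(e₁, …, eₙ)`. -/
theorem topForm_apply (v : Fin n → TangentSpace (𝓡 n) x) :
    μ x v = (Matrix.of fun a i ↦ d (q a) x (v i)).det * μ x (fun i ↦ e i x) := by
  have h := congrArg (fun f ↦ f v)
    (AlternatingMap.eq_smul_basis_det (hF.basis hx) (μ x).toAlternatingMap)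
  refine h.trans ?_
  rw [AlternatingMap.smul_apply, Module.Basis.det_apply, smul_eq_mul, mul_comm]
  congr 1
  · congr 1
    ext a i
    rw [Module.Basis.toMatrix_apply, hF.basis_repr hx]
    rfl
  · exact congrArg (μ x) (funext fun i ↦ hF.basis_apply hx i)

theorem volume_ne_zero (hμ : IsVolumeForm μ) : μ x (fun i ↦ e i x) ≠ 0 := by
  intro h
  refine hμ.ne_zero x ?_
  ext v
  rw [hF.topForm_apply hx, h]
  simp

/-- The divergence formula `L_X μ = (X(ρ) / ρ + ∑ ∂_a X^a) μ`, multiplied by `ρ = μ(e₁, …, eₙ)`. -/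
theorem lieTopForm_eq (hμ : SmoothTopForm μ) {X : VField n M} (hX : SmoothField X)
    {Y : Fin n → VField n M} (hY : ∀ i, SmoothField (Y i)) :
    μ x (fun i ↦ e i x) * lieTopForm X μ Y x =
      (d (fun y ↦ μ y (fun i ↦ e i y)) x (X x) + μ x (fun i ↦ e i x) *
        ∑ a, d (fun y ↦ d (q a) y (X y)) x (e a x)) * μ x (fun i ↦ Y i x) := by
  set ρ : M → ℝ := fun y ↦ μ y (fun i ↦ e i y) with hρ
  have hρs : SmoothFun (n := n) ρ := hμ e hF.smooth_field
  let F : M → Matrix (Fin n) (Fin n) ℝ := fun y ↦ Matrix.of fun a i ↦ d (q a) y (Y i y)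
  have hFs : SmoothMat (n := n) F := fun a i ↦ (smoothOneForm_d (hF.smooth_fun a)).apply (hY i)
  let B : Matrix (Fin n) (Fin n) ℝ :=
    Matrix.of fun a b ↦ d (fun y ↦ d (q a) y (X y)) x (e b x)
  have h1 : (fun y ↦ μ y (fun i ↦ Y i y)) =ᶠ[𝓝 x] fun y ↦ (F y).det * ρ y := by
    filter_upwards [hF.eventually_mem hx] with y hy using hF.topForm_apply hy _
  have h2 (i : Fin n) : μ x (Function.update (fun j ↦ Y j x) i (mlieBracket (𝓡 n) X (Y i) x)) =
      ((F x).cramer (fun a ↦ matDeriv F x (X x) a i) i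
        - (F x).cramer (fun a ↦ (B * F x) a i) i) * ρ x := by
    rw [hF.topForm_apply hx, ← Pi.sub_apply, ← map_sub, Matrix.cramer_apply]
    congr 2
    ext a j
    by_cases hj : j = i
    · subst hj
      simp only [Matrix.of_apply, Function.update_self, Matrix.updateCol_self, Pi.sub_apply]
      rw [d_mlieBracket (hF.smooth_fun a) hX (hY j),
        hF.apply_eq_sum hx (d (fun y ↦ d (q a) y (X y)) x), Matrix.mul_apply]
      congr 1
      exact Finset.sum_congr rfl fun b _ ↦ mul_comm _ _
    · simp [hj, F]
  have h3 : μ x (fun i ↦ Y i x) = (F x).det * ρ x := hF.topForm_apply hx _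
  have h4 : B.trace = ∑ a, d (fun y ↦ d (q a) y (X y)) x (e a x) := rfl
  rw [lieTopForm, d_congr h1, SmoothFun.d_mul hFs.det hρs, Finset.sum_congr rfl fun i _ ↦ h2 i,
    ← Finset.sum_mul, Finset.sum_sub_distrib, sum_cramer_mul, ← d_det hFs, h3, ← h4]
  simp only [_root_.add_apply, _root_.smul_apply, smul_eq_mul]
  change ρ x * _ = (d ρ x (X x) + ρ x * _) * _
  ring

end IsCoordFrame

end

/-! ### Modular vector fields -/

section

variable {n : ℕ} {M : Type*} [TopologicalSpace M]
  [ChartedSpace (EuclideanSpace ℝ (Fin n)) M] [IsManifold (𝓡 n) ∞ M]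

/-- The components of the modular vector field of `Q` in a coordinate frame: with `μ = ρ dq¹ ⋯ dqⁿ`,
they are `∑ a, (∂_a Q^{ba} + Q^{ba} ∂_a ρ / ρ)`. -/
def modularComponent (q : Fin n → M → ℝ) (e : Fin n → VField n M) (Q : BiField n M)
    (μ : TopForm n M) (b : Fin n) (x : M) : ℝ :=
  ∑ a, (d (fun y ↦ biMat q Q y b a) x (e a x)
    + biMat q Q x b a * (d (fun y ↦ μ y (fun i ↦ e i y)) x (e a x) * (μ x (fun i ↦ e i x))⁻¹))

variable {Q : BiField n M} {μ : TopForm n M}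

namespace IsCoordFrame

variable {q : Fin n → M → ℝ} {e : Fin n → VField n M} {U : Set M} (hF : IsCoordFrame q e U)
  {x : M} (hx : x ∈ U)
include hF hx

/-- Second partial derivatives commute. -/
theorem d_d_comm {f : M → ℝ} (hf : SmoothFun (n := n) f) (a b : Fin n) :
    d (fun y ↦ d f y (e b y)) x (e a x) = d (fun y ↦ d f y (e a y)) x (e b x) := by
  have h := d_mlieBracket hf (hF.smooth_field a) (hF.smooth_field b) x
  rw [hF.mlieBracket_field_field hx, map_zero] at h
  linarith

/-- For a skew tensor `Q`, the divergence of `Q df` is the derivative of `f` along the field with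
components `modularComponent`. -/
theorem lieTopForm_hamiltonian (hμ : IsVolumeForm μ)
    (hskew : ∀ (x : M) (α β : TangentSpace (𝓡 n) x →L[ℝ] ℝ), β (Q x α) = -α (Q x β))
    (hQ : ∀ f, SmoothFun (n := n) f → SmoothField (hamiltonian Q f)) {f : M → ℝ}
    (hf : SmoothFun (n := n) f) {Y : Fin n → VField n M} (hY : ∀ i, SmoothField (Y i)) :
    lieTopForm (hamiltonian Q f) μ Y x =
      (∑ b, modularComponent q e Q μ b x * d f x (e b x)) * μ x (fun i ↦ Y i x) := by
  have hQs := hF.smoothMat_biMat hQ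
  have hsk (i j) : biMat q Q x i j = -biMat q Q x j i := hskew _ _ _
  have hf' (b) : SmoothFun (n := n) fun y ↦ d f y (e b y) :=
    (smoothOneForm_d hf).apply (hF.smooth_field b)
  have hcomp (a : Fin n) {y : M} (hy : y ∈ U) :
      d (q a) y (hamiltonian Q f y) = ∑ b, biMat q Q y b a * d f y (e b y) := by
    rw [hamiltonian, hskew, hF.apply_eq_sum hy, ← Finset.sum_neg_distrib]
    refine Finset.sum_congr rfl fun b _ ↦ ?_
    rw [hskew, neg_mul, neg_neg]
    rfl
  have hdiv (a : Fin n) : d (fun y ↦ d (q a) y (hamiltonian Q f y)) x (e a x) =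
      ∑ b, (biMat q Q x b a * d (fun y ↦ d f y (e b y)) x (e a x)
        + d f x (e b x) * d (fun y ↦ biMat q Q y b a) x (e a x)) := by
    rw [d_congr ((hF.eventually_mem hx).mono fun y hy ↦ hcomp a hy),
      SmoothFun.d_sum fun b _ ↦ (hQs b a).mul (hf' b), _root_.sum_apply]
    refine Finset.sum_congr rfl fun b _ ↦ ?_
    rw [SmoothFun.d_mul (hQs b a) (hf' b)]
    rfl
  -- a skew tensor contracted with the symmetric second derivatives of `f`
  have hzero : ∑ a, ∑ b, biMat q Q x b a * d (fun y ↦ d f y (e b y)) x (e a x) = 0 := by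
    have h : ∑ a, ∑ b, biMat q Q x b a * d (fun y ↦ d f y (e b y)) x (e a x) =
        -∑ a, ∑ b, biMat q Q x b a * d (fun y ↦ d f y (e b y)) x (e a x) := by
      conv_lhs => rw [Finset.sum_comm]
      simp only [← Finset.sum_neg_distrib]
      refine Finset.sum_congr rfl fun a _ ↦ Finset.sum_congr rfl fun b _ ↦ ?_
      rw [hsk, hF.d_d_comm hx hf]
      ring
    linarith
  have hρ := hF.volume_ne_zero hx hμ
  refine mul_left_cancel₀ hρ ?_
  rw [hF.lieTopForm_eq hx hμ.smooth (hQ f hf) hY, ← mul_assoc]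
  congr 1
  rw [hF.apply_eq_sum hx (d (fun y ↦ μ y (fun i ↦ e i y)) x)]
  simp only [hdiv, Finset.sum_add_distrib, hzero, hcomp _ hx, modularComponent, Finset.mul_sum,
    Finset.sum_mul, zero_add, add_mul, mul_add]
  rw [add_comm, Finset.sum_comm]
  congr 1
  · exact Finset.sum_congr rfl fun a _ ↦ Finset.sum_congr rfl fun b _ ↦ by ring
  · rw [Finset.sum_comm]
    refine Finset.sum_congr rfl fun a _ ↦ Finset.sum_congr rfl fun b _ ↦ ?_
    field_simp

/-- The components of a tangent vector that satisfies the defining equation of the modular vector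
field at one point. -/
theorem d_apply_of_modular (hμ : IsVolumeForm μ)
    (hskew : ∀ (x : M) (α β : TangentSpace (𝓡 n) x →L[ℝ] ℝ), β (Q x α) = -α (Q x β))
    (hQ : ∀ f, SmoothFun (n := n) f → SmoothField (hamiltonian Q f))
    {v : TangentSpace (𝓡 n) x} (hv : ∀ f : M → ℝ, SmoothFun (n := n) f →
      ∀ Y : Fin n → VField n M, (∀ i, SmoothField (Y i)) →
        d f x v * μ x (fun i ↦ Y i x) = lieTopForm (hamiltonian Q f) μ Y x) (b : Fin n) :
    d (q b) x v = modularComponent q e Q μ b x := by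
  have h := hv (q b) (hF.smooth_fun b) e hF.smooth_field
  rw [hF.lieTopForm_hamiltonian hx hμ hskew hQ (hF.smooth_fun b) hF.smooth_field] at h
  have h' := mul_right_cancel₀ (hF.volume_ne_zero hx hμ) h
  simpa [hF.dual x hx] using h'

theorem smoothAt_modularComponent (hμ : IsVolumeForm μ)
    (hQ : ∀ f, SmoothFun (n := n) f → SmoothField (hamiltonian Q f)) (b : Fin n) :
    ContMDiffAt (𝓡 n) 𝓘(ℝ, ℝ) ∞ (modularComponent q e Q μ b) x := by
  have hQs := hF.smoothMat_biMat hQ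
  have hρ : SmoothFun (n := n) fun y ↦ μ y (fun i ↦ e i y) := hμ.smooth e hF.smooth_field
  refine contMDiffAt_finsetSum fun a _ ↦ ?_
  refine ContMDiffAt.add ((smoothOneForm_d (hQs b a)).apply (hF.smooth_field a) x) ?_
  refine ContMDiffAt.mul (hQs b a x) ?_
  exact ContMDiffAt.mul ((smoothOneForm_d hρ).apply (hF.smooth_field a) x)
    (ContMDiffAt.inv₀ (hρ x) (hF.volume_ne_zero hx hμ))

end IsCoordFrame

/-- Every skew tensor `Q` with smooth hamiltonian fields has exactly one modular vector field; the
Jacobi identity plays no role. -/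
theorem existsUnique_isModularField [T2Space M] (hμ : IsVolumeForm μ)
    (hskew : ∀ (x : M) (α β : TangentSpace (𝓡 n) x →L[ℝ] ℝ), β (Q x α) = -α (Q x β))
    (hQ : ∀ f, SmoothFun (n := n) f → SmoothField (hamiltonian Q f)) :
    ∃! X : VField n M, IsModularField Q μ X := by
  have hex (x : M) : ∃ v : TangentSpace (𝓡 n) x, ∀ f : M → ℝ, SmoothFun (n := n) f →
      ∀ Y : Fin n → VField n M, (∀ i, SmoothField (Y i)) →
        d f x v * μ x (fun i ↦ Y i x) = lieTopForm (hamiltonian Q f) μ Y x := by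
    obtain ⟨q, e, U, hx, hF⟩ := exists_isCoordFrame (n := n) x
    refine ⟨∑ b, modularComponent q e Q μ b x • e b x, fun f hf Y hY ↦ ?_⟩
    rw [hF.lieTopForm_hamiltonian hx hμ hskew hQ hf hY]
    simp
  choose X hX using hex
  refine ⟨X, ⟨fun x ↦ ?_, fun f hf Y hY x ↦ hX x f hf Y hY⟩, fun X' hX' ↦ funext fun x ↦ ?_⟩
  · obtain ⟨q, e, U, hx, hF⟩ := exists_isCoordFrame (n := n) x
    have h : ∀ᶠ y in 𝓝 x, X y = ∑ b, modularComponent q e Q μ b y • e b y := by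
      filter_upwards [hF.eventually_mem hx] with y hy
      rw [← hF.sum_smul hy (X y)]
      refine Finset.sum_congr rfl fun b _ ↦ ?_
      rw [hF.d_apply_of_modular hy hμ hskew hQ (hX y)]
    have hs : ContMDiffAt (𝓡 n) ((𝓡 n).prod 𝓘(ℝ, EuclideanSpace ℝ (Fin n))) ∞
        (fun y ↦ TotalSpace.mk' (EuclideanSpace ℝ (Fin n)) y
          (∑ b, modularComponent q e Q μ b y • e b y)) x :=
      ContMDiffAt.sum_section fun b _ ↦
        (hF.smoothAt_modularComponent hx hμ hQ b).smul_section (hF.smooth_field b x)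
    exact hs.congr_of_eventuallyEq (h.mono fun y hy ↦ congrArg (TotalSpace.mk' _ y) hy)
  · obtain ⟨q, e, U, hx, hF⟩ := exists_isCoordFrame (n := n) x
    refine hF.ext hx fun b ↦ ?_
    rw [hF.d_apply_of_modular hx hμ hskew hQ fun f hf Y hY ↦ hX'.eq f hf Y hY x,
      hF.d_apply_of_modular hx hμ hskew hQ (hX x)]

end

/-! ### Traces, involution and the hierarchy -/

section

/-- The torsion identity `ht` in components, contracted with a matrix `S` that commutes with `N`;
it is applied to `S = N^k`. -/
theorem sum_mul_trace_of_torsion {n : ℕ} {N S : Matrix (Fin n) (Fin n) ℝ}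
    {DN : Fin n → Matrix (Fin n) (Fin n) ℝ} (hSN : S * N = N * S)
    (ht : ∀ i a b, ∑ c, N c a * DN c i b - ∑ c, N c b * DN c i a
      + ∑ c, N i c * DN b c a - ∑ c, N i c * DN a c b = 0) (a : Fin n) :
    ∑ c, N c a * (S * DN c).trace = (S * N * DN a).trace := by
  have h0 : ∑ b, ∑ i, S b i * (∑ c, N c a * DN c i b - ∑ c, N c b * DN c i a
      + ∑ c, N i c * DN b c a - ∑ c, N i c * DN a c b) = 0 := by simp [ht]
  have h1 : ∑ b, ∑ i, S b i * ∑ c, N c a * DN c i b = ∑ c, N c a * (S * DN c).trace := by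
    simp only [Matrix.trace, Matrix.diag_apply, Matrix.mul_apply, Finset.mul_sum]
    rw [Finset.sum_congr rfl fun k _ ↦ Finset.sum_comm, Finset.sum_comm]
    exact Finset.sum_congr rfl fun a _ ↦ Finset.sum_congr rfl fun k _ ↦
      Finset.sum_congr rfl fun j _ ↦ by ring
  have h2 : ∑ b, ∑ i, S b i * ∑ c, N i c * DN a c b = (S * N * DN a).trace := by
    rw [Matrix.mul_assoc]
    simp only [Matrix.trace, Matrix.diag_apply, Matrix.mul_apply]
  -- the two middle terms cancel because `S` and `N` commute
  have h3 : ∑ b, ∑ i, S b i * ∑ c, N c b * DN c i a = ∑ b, ∑ i, S b i * ∑ c, N i c * DN b c a := by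
    have h : ∑ c, ∑ i, (N * S) c i * DN c i a = ∑ b, ∑ c, (S * N) b c * DN b c a := by rw [hSN]
    simp only [Matrix.mul_apply, Finset.sum_mul, mul_assoc] at h
    simp only [Finset.mul_sum]
    rw [Finset.sum_congr rfl fun b _ ↦ Finset.sum_comm, Finset.sum_comm]
    rw [Finset.sum_congr rfl fun b (_ : b ∈ Finset.univ) ↦ Finset.sum_comm
      (f := fun i c ↦ S b i * (N i c * DN b c a)), ← h]
    refine Finset.sum_congr rfl fun c _ ↦ ?_
    rw [Finset.sum_comm]
    exact Finset.sum_congr rfl fun a _ ↦ Finset.sum_congr rfl fun j _ ↦ by ring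
  simp only [mul_add, mul_sub, Finset.sum_add_distrib, Finset.sum_sub_distrib] at h0
  linarith

variable {n : ℕ} {M : Type*} [TopologicalSpace M]
  [ChartedSpace (EuclideanSpace ℝ (Fin n)) M] [IsManifold (𝓡 n) ∞ M]
  {P : BiField n M} {N : EndField n M} {μ : TopForm n M}

theorem IsCoordFrame.traceFun_eventuallyEq {q : Fin n → M → ℝ} {e : Fin n → VField n M} {U : Set M}
    (hF : IsCoordFrame q e U) {x : M} (hx : x ∈ U) (N : EndField n M) (k : ℕ) :
    traceFun N k =ᶠ[𝓝 x] fun y ↦ 1 / (k : ℝ) * (endMat q e N y ^ k).trace := by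
  filter_upwards [hF.eventually_mem hx] with y hy
  rw [traceFun, hF.trace_pow hy]

theorem IsCoordFrame.d_traceFun {q : Fin n → M → ℝ} {e : Fin n → VField n M} {U : Set M}
    (hF : IsCoordFrame q e U) {x : M} (hx : x ∈ U) (hN : SmoothEnd N) (k : ℕ)
    (v : TangentSpace (𝓡 n) x) : d (traceFun N (k + 1)) x v =
      (endMat q e N x ^ k * matDeriv (endMat q e N) x v).trace := by
  have hNs := hF.smoothMat_endMat hN
  rw [d_congr (hF.traceFun_eventuallyEq hx N (k + 1)),
    SmoothFun.d_mul (smoothFun_const _) (hNs.pow _).trace, d_const, smul_zero, add_zero,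
    _root_.smul_apply, d_trace_pow hNs, smul_eq_mul]
  push_cast
  field_simp

theorem smoothFun_traceFun [T2Space M] (hN : SmoothEnd N) (k : ℕ) :
    SmoothFun (n := n) (traceFun N k) := by
  intro x
  obtain ⟨q, e, U, hx, hF⟩ := exists_isCoordFrame (n := n) x
  have h : SmoothFun (n := n) fun y ↦ 1 / (k : ℝ) * (endMat q e N y ^ k).trace :=
    (smoothFun_const _).mul ((hF.smoothMat_endMat hN).pow k).trace
  exact (h x).congr_of_eventuallyEq (hF.traceFun_eventuallyEq hx N k)

/-- The recursion `N dI_k = dI_{k+1}`. -/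
theorem IsNijenhuis.d_traceFun_apply [T2Space M] (hN : IsNijenhuis N) {k : ℕ} (hk : 1 ≤ k) (x : M)
    (v : TangentSpace (𝓡 n) x) :
    d (traceFun N k) x (N x v) = d (traceFun N (k + 1)) x v := by
  obtain ⟨k, rfl⟩ := Nat.exists_eq_add_of_le' hk
  obtain ⟨q, e, U, hx, hF⟩ := exists_isCoordFrame (n := n) x
  rw [← ContinuousLinearMap.comp_apply, hF.apply_eq_sum hx, hF.apply_eq_sum hx (d _ x)]
  refine Finset.sum_congr rfl fun a _ ↦ ?_
  rw [ContinuousLinearMap.comp_apply, hF.apply_eq_sum hx (d _ x) (N x (e a x)),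
    hF.d_traceFun hx hN.smooth, pow_succ,
    ← sum_mul_trace_of_torsion (Commute.pow_self (endMat q e N x) k).eq
      (fun i a b ↦ hF.torsion_components hx hN i a b)]
  congr 1
  refine Finset.sum_congr rfl fun c _ ↦ ?_
  rw [hF.d_traceFun hx hN.smooth]
  rfl

namespace IsPoissonNijenhuis

variable (hPN : IsPoissonNijenhuis P N)
include hPN

/-- `P_l dI_k = P dI_{k+l}`, by `N P = P Nᵗ` and `N dI_k = dI_{k+1}`. -/
theorem hamiltonian_iterBi_traceFun [T2Space M] {k : ℕ} (hk : 1 ≤ k) (l : ℕ) (x : M) :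
    hamiltonian (iterBi N P l) (traceFun N k) x = hamiltonian P (traceFun N (k + l)) x := by
  induction l with
  | zero => simp [hamiltonian, iterBi]
  | succ l ih =>
    have h : hamiltonian (iterBi N P (l + 1)) (traceFun N k) x =
        N x (hamiltonian (iterBi N P l) (traceFun N k) x) := by
      simp only [hamiltonian, iterBi, pow_succ']; rfl
    rw [h, ih, hamiltonian, hPN.comm, hamiltonian]
    congr 1
    ext v
    exact hPN.nijenhuis.d_traceFun_apply (by lia) x v

theorem bracket_traceFun [T2Space M] {j k : ℕ} (hj : 1 ≤ j) (hk : 1 ≤ k) (l : ℕ) (x : M) :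
    bracket (iterBi N P l) (traceFun N j) (traceFun N k) x = 0 := by
  let A (j k : ℕ) : ℝ := d (traceFun N k) x (hamiltonian P (traceFun N j) x)
  have hskew (j k) : A j k = -A k j := hPN.poisson.skew _ _ _
  have hshift {j k : ℕ} (hj : 1 ≤ j) (hk : 1 ≤ k) : A (j + 1) k = A j (k + 1) := by
    have h : hamiltonian P (traceFun N (j + 1)) x = N x (hamiltonian P (traceFun N j) x) := by
      rw [← hPN.hamiltonian_iterBi_traceFun hj 1, hamiltonian, iterBi, pow_one]; rfl
    simp only [A, h]
    exact hPN.nijenhuis.d_traceFun_apply hk x _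
  -- `A j k` depends on `j + k` only, and is skew
  have hsum (m : ℕ) {j k : ℕ} (hj : 1 ≤ j) (hk : 1 ≤ k) : A (j + m) k = A j (k + m) := by
    induction m generalizing k with
    | zero => rfl
    | succ m ih =>
      rw [← add_assoc, hshift (by lia) hk, ih (by lia)]
      congr 1
      lia
  have hsymm {j k : ℕ} (hj : 1 ≤ j) (hk : 1 ≤ k) (h : j ≤ k) : A j k = 0 := by
    obtain ⟨m, rfl⟩ := Nat.exists_eq_add_of_le h
    have := hsum m hj hj
    have := hskew j (j + m)
    linarith
  have hzero {j k : ℕ} (hj : 1 ≤ j) (hk : 1 ≤ k) : A j k = 0 := by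
    rcases le_total j k with h | h
    · exact hsymm hj hk h
    · rw [hskew, hsymm hk hj h, neg_zero]
  rw [bracket, hPN.hamiltonian_iterBi_traceFun hj]
  exact hzero (by lia) hk

/-- `X^{(k+1)} = -½ P dI_{k+1}`, checked on the coordinate functions of a frame. -/
theorem modularHierarchy_eq [T2Space M] (hμ : IsVolumeForm μ) {Xμ : ℕ → VField n M}
    (hX : ∀ k, IsModularField (iterBi N P k) μ (Xμ k)) (k : ℕ) (x : M) :
    modularHierarchy N Xμ (k + 1) x =
      (-(1 / 2) : ℝ) • hamiltonian P (traceFun N (k + 1)) x := by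
  obtain ⟨q, e, U, hx, hF⟩ := exists_isCoordFrame (n := n) x
  have hNs := hF.smoothMat_endMat hPN.nijenhuis.smooth
  have hPs (k) := hF.smoothMat_biMat fun f hf ↦ hPN.smoothField_iterBi k (f := f) hf
  have hP0 : SmoothMat (biMat q P) :=
    hF.smoothMat_biMat fun f hf ↦ hPN.smoothField_hamiltonian (f := f) hf
  have hmod (k b) : d (q b) x (Xμ k x) = modularComponent q e (iterBi N P k) μ b x :=
    hF.d_apply_of_modular hx hμ (hPN.iterBi_skew k) (fun f hf ↦ hPN.smoothField_iterBi k hf)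
      (fun f hf Y hY ↦ (hX k).eq f hf Y hY x) b
  have hsk (k : ℕ) (y : M) : (biMat q (iterBi N P k) y)ᵀ = -biMat q (iterBi N P k) y := by
    ext i j
    exact hPN.iterBi_skew k _ _ _
  have hsk0 (y : M) : (biMat q P y)ᵀ = -biMat q P y := by
    ext i j
    exact hPN.poisson.skew _ _ _
  have hNPk {y : M} (hy : y ∈ U) (k : ℕ) :
      endMat q e N y ^ k * biMat q P y = biMat q P y * (endMat q e N y ^ k)ᵀ := by
    have h := hsk k y
    rw [hF.biMat_iterBi hy, Matrix.transpose_mul, Matrix.transpose_transpose, hsk0,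
      mul_neg, neg_inj] at h
    exact h
  -- both `P_{k+1}` and `P_k` are skew, so the factor `N` may be put on the left
  have hsucc (y : M) (hy : y ∈ U) : biMat q (iterBi N P (k + 1)) y =
      endMat q e N y * biMat q (iterBi N P k) y := by
    rw [hF.biMat_iterBi hy, hF.biMat_iterBi hy, ← hNPk hy, ← hNPk hy, pow_succ', Matrix.mul_assoc]
  have hDsk (c : Fin n) : (matDeriv (biMat q P) x (e c x))ᵀ = -matDeriv (biMat q P) x (e c x) := by
    ext i j
    rw [Matrix.transpose_apply, Matrix.neg_apply, matDeriv_apply, matDeriv_apply,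
      ← _root_.neg_apply, ← d_neg]
    congr 3
    funext y
    exact congrFun (congrFun (hsk0 y) i) j
  have hDNP (c : Fin n) : matDeriv (endMat q e N) x (e c x) * biMat q P x
      + endMat q e N x * matDeriv (biMat q P) x (e c x)
      = matDeriv (biMat q P) x (e c x) * (endMat q e N x)ᵀ
        + biMat q P x * (matDeriv (endMat q e N) x (e c x))ᵀ := by
    rw [← matDeriv_mul hNs hP0, ← matDeriv_transpose, ← matDeriv_mul hP0 hNs.transpose]
    refine matDeriv_congr ((hF.eventually_mem hx).mono fun y hy ↦ ?_)
    simpa using hNPk hy 1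
  have hkey := sum_two_mul_of_compat hDsk (Commute.pow_self (endMat q e N x) k).eq (hNPk hx k)
    hDNP fun i j c ↦ by
      rw [← hF.compat_components hx hPN, matDeriv_mul hP0 hNs.transpose, matDeriv_transpose]
  refine hF.ext hx fun b ↦ ?_
  have hrhs : d (q b) x ((-(1 / 2) : ℝ) • hamiltonian P (traceFun N (k + 1)) x) =
      1 / 2 * ∑ a, biMat q P x b a *
        (endMat q e N x ^ k * matDeriv (endMat q e N) x (e a x)).trace := by
    rw [map_smul, hamiltonian, hPN.poisson.skew, hF.apply_eq_sum hx, smul_eq_mul, neg_mul_neg]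
    congr 1
    refine Finset.sum_congr rfl fun a _ ↦ ?_
    rw [hF.d_traceFun hx hPN.nijenhuis.smooth]
    rfl
  have hder (c : Fin n) : d (fun y ↦ biMat q (iterBi N P (k + 1)) y b c) x (e c x) =
      ∑ a, (matDeriv (endMat q e N) x (e c x) b a * biMat q (iterBi N P k) x a c
        + endMat q e N x b a * d (fun y ↦ biMat q (iterBi N P k) y a c) x (e c x)) := by
    have h : matDeriv (biMat q (iterBi N P (k + 1))) x (e c x) b c = _ :=
      congrFun (congrFun (matDeriv_congr ((hF.eventually_mem hx).mono hsucc)) b) c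
    rw [matDeriv_mul hNs (hPs k), Matrix.add_apply, Matrix.mul_apply, Matrix.mul_apply,
      ← Finset.sum_add_distrib] at h
    exact h
  -- the terms with `ρ` and with derivatives of `P_k` cancel, `∑ (∂_c N^b_a) P_k^{ac}` remains
  rw [hrhs, ← hkey, modularHierarchy, map_sub, hF.d_apply_end hx, Nat.add_sub_cancel]
  simp only [hmod, modularComponent, hder]
  rw [← hF.biMat_iterBi hx, hsucc x hx]
  simp only [Matrix.mul_apply]
  rw [Finset.sum_congr rfl fun a (_ : a ∈ Finset.univ) ↦ Finset.mul_sum _ _ (endMat q e N x b a),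
    Finset.sum_comm (f := fun a c ↦ endMat q e N x b a * _), ← Finset.sum_sub_distrib, ← mul_assoc]
  norm_num only [one_mul]
  refine Finset.sum_congr rfl fun c _ ↦ ?_
  rw [Finset.sum_mul, ← Finset.sum_add_distrib, ← Finset.sum_sub_distrib]
  exact Finset.sum_congr rfl fun a _ ↦ by ring

end IsPoissonNijenhuis

end

end PoissonNijenhuis

end

theorem mainTheorem1 {n : ℕ} {M : Type*} [TopologicalSpace M] [T2Space M]
    [ChartedSpace (EuclideanSpace ℝ (Fin n)) M] [IsManifold (𝓡 n) ∞ M]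
    (P : PoissonNijenhuis.BiField n M) (N : PoissonNijenhuis.EndField n M)
    (hPN : PoissonNijenhuis.IsPoissonNijenhuis P N)
    (μ : PoissonNijenhuis.TopForm n M) (hμ : PoissonNijenhuis.IsVolumeForm μ) :
    -- each `P_k = N^k P` has exactly one modular vector field with respect to `μ`
    (∀ k : ℕ, ∃! X : PoissonNijenhuis.VField n M,
      PoissonNijenhuis.IsModularField (PoissonNijenhuis.iterBi N P k) μ X) ∧
    -- the functions `I_k` are smooth and in involution for every `P_l`
    (∀ k : ℕ, 1 ≤ k → PoissonNijenhuis.SmoothFun (n := n) (PoissonNijenhuis.traceFun N k)) ∧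
    (∀ j k l : ℕ, 1 ≤ j → 1 ≤ k → ∀ x : M,
      PoissonNijenhuis.bracket (PoissonNijenhuis.iterBi N P l)
        (PoissonNijenhuis.traceFun N j) (PoissonNijenhuis.traceFun N k) x = 0) ∧
    ∀ Xμ : ℕ → PoissonNijenhuis.VField n M,
      (∀ k, PoissonNijenhuis.IsModularField (PoissonNijenhuis.iterBi N P k) μ (Xμ k)) →
      -- `X^{(k)} = -½ P dI_k`
      (∀ k : ℕ, 1 ≤ k → ∀ x : M,
        PoissonNijenhuis.modularHierarchy N Xμ k x
          = (-(1 / 2) : ℝ) •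
            PoissonNijenhuis.hamiltonian P (PoissonNijenhuis.traceFun N k) x) ∧
      -- the hierarchy is bihamiltonian: `X^{(k+1)} = N X^{(k)} = -½ (NP) dI_k`
      (∀ k : ℕ, 1 ≤ k → ∀ x : M,
        PoissonNijenhuis.modularHierarchy N Xμ (k + 1) x
          = N x (PoissonNijenhuis.modularHierarchy N Xμ k x) ∧
        PoissonNijenhuis.modularHierarchy N Xμ (k + 1) x
          = (-(1 / 2) : ℝ) •
            PoissonNijenhuis.hamiltonian (PoissonNijenhuis.iterBi N P 1)
              (PoissonNijenhuis.traceFun N k) x) := by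
  open PoissonNijenhuis in
  refine ⟨fun k ↦ existsUnique_isModularField hμ (hPN.iterBi_skew k)
      fun f hf ↦ hPN.smoothField_iterBi k hf,
    fun k _ ↦ smoothFun_traceFun hPN.nijenhuis.smooth k,
    fun j k l hj hk x ↦ hPN.bracket_traceFun hj hk l x, fun Xμ hX ↦ ?_⟩
  have hier (k : ℕ) (hk : 1 ≤ k) (x : M) : modularHierarchy N Xμ k x =
      (-(1 / 2) : ℝ) • hamiltonian P (traceFun N k) x := by
    obtain ⟨k, rfl⟩ := Nat.exists_eq_add_of_le' hk
    exact hPN.modularHierarchy_eq hμ hX k x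
  have hsucc (k : ℕ) (hk : 1 ≤ k) (x : M) : modularHierarchy N Xμ (k + 1) x =
      (-(1 / 2) : ℝ) • hamiltonian (iterBi N P 1) (traceFun N k) x := by
    rw [hier (k + 1) (by lia), hPN.hamiltonian_iterBi_traceFun hk]
  refine ⟨hier, fun k hk x ↦ ⟨?_, hsucc k hk x⟩⟩
  rw [hsucc k hk, hier k hk, map_smul, hamiltonian, iterBi, pow_one]
  rfl
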